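/- Let $d\ge 1$ and let $(\mathbf{x}_t)_{t\in[0,T]}$ be random vectors in $\mathbb{R}^d$ on a probability space such that, for every $t\in[0,T]$, the conditional law of $\mathbf{x}_t$ given the data $\mathbf{x}_0$ is the Gaussian $\mathcal{N}(\alpha_t\mathbf{x}_0,\sigma_t^2 I)$, where $\alpha,\sigma$ are real functions of $t$. Let $E_\varphi$ be a measurable map (the encoder) from $\mathbb{R}^d$ to a standard Borel space $Z$, fix $t\in[0,T]$, let $(x,z)\mapsto\mathbf{x}_\theta(x,t,z)$ be a measurable map $\mathbb{R}^d\times Z\to\mathbb{R}^d$ (the denoiser), and let $$\mathcal{L}_t=\mathbb{E}\big[\|\mathbf{x}_\theta(\mathbf{x}_t,t,E_\varphi(\mathbf{x}_0))-\mathbf{x}_0\|^2\big]\in[0,\infty]$$ be the conditional denoising score matching loss at time $t$. Let $h(\mathbf{x}_0\mid\mathbf{x}_t)=-\mathbb{E}[\log p(\mathbf{x}_0\mid\mathbf{x}_t)]$ be the conditional differential entropy, in nats, and $I(\mathbf{x}_0;E_\varphi(\mathbf{x}_0)\mid\mathbf{x}_t)\in[0,\infty]$ the conditional mutual information, that is,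 the expectation over $\mathbf{x}_t$ of the Kullback–Leibler divergence of the conditional joint law of $(\mathbf{x}_0,E_\varphi(\mathbf{x}_0))$ given $\mathbf{x}_t$ from the product of its conditional marginals. Then, if $d\ge 2$, $$I(\mathbf{x}_0;E_\varphi(\mathbf{x}_0)\mid\mathbf{x}_t)\ \ge\ -\log\mathcal{L}_t+\log\Big(\frac{d}{2\pi e}\Big)+\frac{2}{d}\,h(\mathbf{x}_0\mid\mathbf{x}_t),$$ and, for every $d\ge 1$, $$\frac{2}{d}\,I(\mathbf{x}_0;E_\varphi(\mathbf{x}_0)\mid\mathbf{x}_t)\ \ge\ -\log\mathcal{L}_t+\log\Big(\frac{d}{2\pi e}\Big)+\frac{2}{d}\,h(\mathbf{x}_0\mid\mathbf{x}_t).$$ All quantities are extended real numbers. The entropy $h(\mathbf{x}_0\mid\mathbf{x}_t)$ is taken to be $-\infty$ when $\mathbf{x}_0$ has no conditional density given $\mathbf{x}_t$, or when the positive and negative parts of $\log p(\mathbf{x}_0\mid\mathbf{x}_t)$ both have infinite expectation; a sum in which $+\infty$ and $-\infty$ both occur is read as $-\infty$. -/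

import Mathlib

open MeasureTheory ProbabilityTheory InformationTheory Set
open scoped ENNReal

noncomputable section

/-- Conditional mutual information `I(X ; Y | Z) = D(P_{Z,X,Y} ‖ P_Z ⊗ (P_{X|Z} × P_{Y|Z}))`,
with values in `[0, ∞]`: the average over `Z` of the Kullback-Leibler divergence of the
conditional joint law of `(X, Y)` from the product of its conditional marginals. -/
def condMutualInfo {Ω A B C : Type*} [MeasurableSpace Ω]
    [MeasurableSpace A] [StandardBorelSpace A] [Nonempty A]
    [MeasurableSpace B] [StandardBorelSpace B] [Nonempty B]
    [MeasurableSpace C] (P : Measure Ω) [IsFiniteMeasure P]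
    (X : Ω → A) (Y : Ω → B) (Z : Ω → C) : ℝ≥0∞ :=
  klDiv (P.map (fun ω => (Z ω, (X ω, Y ω))))
    (P.map Z ⊗ₘ (condDistrib X Z P ×ₖ condDistrib Y Z P))

/-- The conditional density `p(x | z)` of `X` given `Z` with respect to Lebesgue measure: the
density of the law of `(Z, X)` with respect to `P_Z ⊗ Lebesgue`. -/
def condDensity {Ω C : Type*} [MeasurableSpace Ω] [MeasurableSpace C] {d : ℕ} (P : Measure Ω)
    (X : Ω → EuclideanSpace ℝ (Fin d)) (Z : Ω → C) : C × EuclideanSpace ℝ (Fin d) → ℝ≥0∞ :=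
  (P.map (fun ω => (Z ω, X ω))).rnDeriv
    ((P.map Z).prod (volume : Measure (EuclideanSpace ℝ (Fin d))))

open Classical in
/-- Conditional differential entropy `h(X | Z) = -E[log p(X | Z)]` (in nats), as an extended real:
the expectation of the positive part of `-log p(X | Z)` minus that of its negative part. It is
`-∞` when `X` has no conditional density given `Z`, and also, by convention, when both parts have
infinite expectation. -/
def condDiffEntropy {Ω C : Type*} [MeasurableSpace Ω] [MeasurableSpace C] {d : ℕ} (P : Measure Ω)
    (X : Ω → EuclideanSpace ℝ (Fin d)) (Z : Ω → C) : EReal :=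
  if P.map (fun ω => (Z ω, X ω)) ≪
      (P.map Z).prod (volume : Measure (EuclideanSpace ℝ (Fin d))) then
    ((∫⁻ ω, ENNReal.ofReal (-Real.log (condDensity P X Z (Z ω, X ω)).toReal) ∂P : ℝ≥0∞) : EReal)
      - ((∫⁻ ω, ENNReal.ofReal (Real.log (condDensity P X Z (Z ω, X ω)).toReal) ∂P : ℝ≥0∞) : EReal)
  else ⊥

/-- `x` is a forward noising process on `[0, T]` with coefficients `α`, `σ`: given the data `x 0`,
the noisy sample `x t` has law `N(α t • x 0, (σ t)² I)` for every `t ∈ [0, T]`. -/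
structure IsForwardProcess {Ω : Type*} [MeasurableSpace Ω] {d : ℕ} (P : Measure Ω)
    [IsFiniteMeasure P] (T : ℝ) (α σ : ℝ → ℝ) (x : ℝ → Ω → EuclideanSpace ℝ (Fin d)) : Prop where
  measurable : ∀ t ∈ Icc 0 T, Measurable (x t)
  transition : ∀ t ∈ Icc 0 T, ∀ᵐ y ∂(P.map (x 0)),
    condDistrib (x t) (x 0) P y =
      multivariateGaussian (α t • y) ((σ t) ^ 2 • (1 : Matrix (Fin d) (Fin d) ℝ))

/-- The conditional denoising score matching loss at time `t`,
`E[‖xθ (x_t, t, E_φ (x_0)) - x_0‖²]`, with values in `[0, ∞]`. -/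
def condDSMLoss {Ω Z : Type*} [MeasurableSpace Ω] {d : ℕ} (P : Measure Ω)
    (x : ℝ → Ω → EuclideanSpace ℝ (Fin d)) (Eφ : EuclideanSpace ℝ (Fin d) → Z)
    (xθ : EuclideanSpace ℝ (Fin d) → ℝ → Z → EuclideanSpace ℝ (Fin d)) (t : ℝ) : ℝ≥0∞ :=
  ∫⁻ ω, ENNReal.ofReal (‖xθ (x t ω) t (Eφ (x 0 ω)) - x 0 ω‖ ^ 2) ∂P

end

/-!
The theorem is Gibbs' inequality for a Gaussian model. Write `W` for the noisy sample, `V` for the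
code of the data `X`, `p(x | w)` for the conditional density of `X` given `W`, and `r` for the
density of the law of `(W, X, V)` with respect to `P_W ⊗ (P_{X|W} × P_{V|W})`, so that the
conditional mutual information is `I = E[log r]`. Then `r p` is the conditional density of `X` given
`(W, V)`. Let `g` be the Gaussian density with mean the denoised sample and covariance `s • 1`.
Since `E[g / (r p)] ≤ 1` (`lintegral_gaussian_div_condDensity_le`, which is Tonelli's theorem),
integrating `log (g / (r p)) ≤ g / (r p) - 1` gives

  `h(X | W) ≤ I + (d / 2) log (2πs) + L / (2s)`   for every `s > 0`,

where `L` is the mean squared error (`exists_condDiffEntropy_le`). The same pointwise bound shows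
that `log p` is integrable once `h(X | W) ≠ -∞` and `I`, `L` are finite, so all sums are sums of
real numbers. The choice `s = L / d`, or `s → 0` when `L = 0`, yields the bound on `(2 / d) I`
(`neg_log_add_le_condMutualInfo`), and `2 / d ≤ 1` for `d ≥ 2`.
-/

/-! ### The isotropic Gaussian density -/

/-- The density `(2πs)^(-d/2) exp(-‖x‖² / (2s))` of the centred Gaussian law on `ℝ^d` with
covariance `s • 1`, as a function. -/
noncomputable def isotropicGaussianPDF (d : ℕ) (s : ℝ) (x : EuclideanSpace ℝ (Fin d)) : ℝ :=
  ((2 * Real.pi * s) ^ ((d : ℝ) / 2))⁻¹ * Real.exp (-(1 / (2 * s)) * ‖x‖ ^ 2)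

lemma isotropicGaussianPDF_pos {d : ℕ} {s : ℝ} (hs : 0 < s) (x : EuclideanSpace ℝ (Fin d)) :
    0 < isotropicGaussianPDF d s x := by
  have := Real.pi_pos
  unfold isotropicGaussianPDF
  positivity

@[fun_prop]
lemma measurable_isotropicGaussianPDF (d : ℕ) (s : ℝ) :
    Measurable (isotropicGaussianPDF d s) := by
  unfold isotropicGaussianPDF
  fun_prop

lemma log_isotropicGaussianPDF {d : ℕ} {s : ℝ} (hs : 0 < s) (x : EuclideanSpace ℝ (Fin d)) :
    Real.log (isotropicGaussianPDF d s x)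
      = -(d / 2 * Real.log (2 * Real.pi * s)) - 1 / (2 * s) * ‖x‖ ^ 2 := by
  have hpos : 0 < 2 * Real.pi * s := by have := Real.pi_pos; positivity
  unfold isotropicGaussianPDF
  rw [Real.log_mul (by positivity) (Real.exp_pos _).ne', Real.log_inv, Real.log_rpow hpos,
    Real.log_exp]
  ring

lemma lintegral_isotropicGaussianPDF (d : ℕ) {s : ℝ} (hs : 0 < s) :
    ∫⁻ x, ENNReal.ofReal (isotropicGaussianPDF d s x) = 1 := by
  have hpos : 0 < 2 * Real.pi * s := by have := Real.pi_pos; positivity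
  have hint : ∫ x : EuclideanSpace ℝ (Fin d), Real.exp (-(1 / (2 * s)) * ‖x‖ ^ 2)
      = (2 * Real.pi * s) ^ ((d : ℝ) / 2) := by
    rw [GaussianFourier.integral_rexp_neg_mul_sq_norm (by positivity), finrank_euclideanSpace_fin]
    congr 1
    field_simp
  have hone : ∫ x, isotropicGaussianPDF d s x = 1 := by
    unfold isotropicGaussianPDF
    rw [integral_const_mul, hint, inv_mul_cancel₀ (by positivity)]
  -- a nonzero Bochner integral certifies integrability
  have hi : Integrable (isotropicGaussianPDF d s) := by
    by_contra h
    rw [integral_undef h] at hone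
    exact zero_ne_one hone
  rw [← ofReal_integral_eq_lintegral_ofReal hi
    (ae_of_all _ fun x => (isotropicGaussianPDF_pos hs x).le), hone, ENNReal.ofReal_one]

/-! ### Gibbs' inequality against the Gaussian model -/

section Gibbs

variable {Ω B C : Type*} [MeasurableSpace Ω] [MeasurableSpace B] [StandardBorelSpace B]
  [Nonempty B] [MeasurableSpace C] {d : ℕ} {P : Measure Ω} [IsProbabilityMeasure P]
  {X : Ω → EuclideanSpace ℝ (Fin d)} {V : Ω → B} {W : Ω → C}
  {f : C × B → EuclideanSpace ℝ (Fin d)}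

/-- Under `P_W ⊗ (P_{X|W} × P_{V|W})`, the pair `(W, X)` has density `p(x | w)` with respect to
`P_W ⊗ Lebesgue`; cancelling `p` leaves at most the mass `1` of the Gaussian density centred
at `f (w, v)`. -/
lemma lintegral_gaussian_div_condDensity_le (hX : Measurable X) (hW : Measurable W)
    (hf : Measurable f) {s : ℝ} (hs : 0 < s)
    (hac : P.map (fun ω => (W ω, X ω)) ≪
      (P.map W).prod (volume : Measure (EuclideanSpace ℝ (Fin d)))) :
    ∫⁻ q, ENNReal.ofReal (isotropicGaussianPDF d s (q.2.1 - f (q.1, q.2.2)))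
        / condDensity P X W (q.1, q.2.1)
      ∂(P.map W ⊗ₘ (condDistrib X W P ×ₖ condDistrib V W P)) ≤ 1 := by
  have : IsProbabilityMeasure (P.map W) := Measure.isProbabilityMeasure_map hW.aemeasurable
  have hp : Measurable (condDensity P X W) := Measure.measurable_rnDeriv _ _
  set p := condDensity P X W with hpdef
  set κ := condDistrib V W P
  set G : C → EuclideanSpace ℝ (Fin d) → B → ℝ≥0∞ :=
    fun w x v => ENNReal.ofReal (isotropicGaussianPDF d s (x - f (w, v)))
  have hG : Measurable fun q : (C × EuclideanSpace ℝ (Fin d)) × B => G q.1.1 q.1.2 q.2 := by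
    fun_prop
  have hGκ : Measurable fun q : C × EuclideanSpace ℝ (Fin d) => ∫⁻ v, G q.1 q.2 v ∂κ q.1 :=
    Measurable.lintegral_kernel_prod_right' (κ := κ.comap Prod.fst measurable_fst) hG
  have hGp : Measurable fun q : C × EuclideanSpace ℝ (Fin d) =>
      (∫⁻ v, G q.1 q.2 v ∂κ q.1) / p q := hGκ.div hp
  calc ∫⁻ q, ENNReal.ofReal (isotropicGaussianPDF d s (q.2.1 - f (q.1, q.2.2)))
        / p (q.1, q.2.1) ∂(P.map W ⊗ₘ (condDistrib X W P ×ₖ κ))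
      = ∫⁻ w, ∫⁻ x, ∫⁻ v, G w x v / p (w, x) ∂κ w ∂condDistrib X W P w ∂P.map W := by
        rw [Measure.lintegral_compProd (by fun_prop)]
        refine lintegral_congr fun w => ?_
        rw [Kernel.lintegral_prod _ _ _ (by fun_prop)]
    _ = ∫⁻ w, ∫⁻ x, (∫⁻ v, G w x v ∂κ w) / p (w, x) ∂condDistrib X W P w ∂P.map W := by
        refine lintegral_congr fun w => lintegral_congr fun x => ?_
        simp_rw [div_eq_mul_inv]
        rw [lintegral_mul_const _ (by fun_prop)]
    _ = ∫⁻ q, (∫⁻ v, G q.1 q.2 v ∂κ q.1) / p q ∂P.map (fun ω => (W ω, X ω)) := by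
        rw [← compProd_map_condDistrib hX.aemeasurable,
          Measure.lintegral_compProd hGp]
    _ = ∫⁻ q, p q * ((∫⁻ v, G q.1 q.2 v ∂κ q.1) / p q) ∂(P.map W).prod volume := by
        rw [hpdef]
        exact (lintegral_rnDeriv_mul hac hGp.aemeasurable).symm
    _ ≤ ∫⁻ q, (∫⁻ v, G q.1 q.2 v ∂κ q.1) ∂(P.map W).prod volume :=
        lintegral_mono fun q => ENNReal.mul_div_le
    _ = ∫⁻ w, ∫⁻ v, (∫⁻ x, G w x v) ∂κ w ∂P.map W := by
        rw [lintegral_prod _ hGκ.aemeasurable]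
        refine lintegral_congr fun w => ?_
        have hGw : Measurable (Function.uncurry (G w)) :=
          hG.comp (g := fun q : (C × EuclideanSpace ℝ (Fin d)) × B => G q.1.1 q.1.2 q.2)
            (f := fun q : EuclideanSpace ℝ (Fin d) × B => ((w, q.1), q.2)) (by fun_prop)
        exact lintegral_lintegral_swap (μ := volume) (ν := κ w) hGw.aemeasurable
    _ = 1 := by
        have h (w : C) (v : B) : ∫⁻ x, G w x v = 1 := by
          rw [← lintegral_isotropicGaussianPDF d hs]
          exact lintegral_sub_right_eq_self
            (fun x => ENNReal.ofReal (isotropicGaussianPDF d s x)) (f (w, v))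
        simp [h]

/-- Gibbs' inequality for the joint law of `(W, X, V)` against the law under which `X` is Gaussian
with mean `f (W, V)` and covariance `s • 1`. The assumptions on the entropy exclude its value `⊥`;
the entropy is then finite. -/
lemma exists_condDiffEntropy_le (hX : Measurable X) (hV : Measurable V) (hW : Measurable W)
    (hf : Measurable f)
    (hac : P.map (fun ω => (W ω, X ω)) ≪
      (P.map W).prod (volume : Measure (EuclideanSpace ℝ (Fin d))))
    (hB : ∫⁻ ω, ENNReal.ofReal (Real.log (condDensity P X W (W ω, X ω)).toReal) ∂P ≠ ∞)
    (hI : condMutualInfo P X V W ≠ ∞)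
    (hL : ∫⁻ ω, ENNReal.ofReal (‖f (W ω, V ω) - X ω‖ ^ 2) ∂P ≠ ∞) :
    ∃ h : ℝ, condDiffEntropy P X W = h ∧ ∀ s : ℝ, 0 < s →
      h ≤ (condMutualInfo P X V W).toReal + d / 2 * Real.log (2 * Real.pi * s)
        + 1 / (2 * s) * (∫⁻ ω, ENNReal.ofReal (‖f (W ω, V ω) - X ω‖ ^ 2) ∂P).toReal := by
  have hprobW : IsProbabilityMeasure (P.map W) := Measure.isProbabilityMeasure_map hW.aemeasurable
  have hWX : Measurable fun ω => (W ω, X ω) := by fun_prop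
  have hJm : Measurable fun ω => (W ω, (X ω, V ω)) := by fun_prop
  have hprobJ : IsProbabilityMeasure (P.map fun ω => (W ω, (X ω, V ω))) :=
    Measure.isProbabilityMeasure_map hJm.aemeasurable
  have hprobWX : IsProbabilityMeasure (P.map fun ω => (W ω, X ω)) :=
    Measure.isProbabilityMeasure_map hWX.aemeasurable
  obtain ⟨hJQ, hllr⟩ := klDiv_ne_top_iff.1 hI
  have hIeq := toReal_klDiv_of_measure_eq hJQ (by simp)
  set J := P.map fun ω => (W ω, (X ω, V ω)) with hJ
  set Q := P.map W ⊗ₘ (condDistrib X W P ×ₖ condDistrib V W P)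
  set r := J.rnDeriv Q
  have hrm : Measurable r := Measure.measurable_rnDeriv _ _
  have hpm : Measurable (condDensity P X W) := Measure.measurable_rnDeriv _ _
  -- the three log-densities along `ω`: likelihood ratio, conditional density, squared error
  set a : Ω → ℝ := fun ω => Real.log (r (W ω, (X ω, V ω))).toReal with ha
  set b : Ω → ℝ := fun ω => Real.log (condDensity P X W (W ω, X ω)).toReal with hb
  set e : Ω → ℝ := fun ω => ‖f (W ω, V ω) - X ω‖ ^ 2 with he
  have hbm : Measurable b := by fun_prop
  have hem : Measurable e := by fun_prop
  have haint : Integrable a P := hllr.comp_measurable hJm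
  have haI : ∫ ω, a ω ∂P = (condMutualInfo P X V W).toReal := by
    rw [condMutualInfo, hIeq, hJ, integral_map hJm.aemeasurable]
    · rfl
    · exact hllr.aestronglyMeasurable
  have he0 : 0 ≤ᵐ[P] e := ae_of_all _ fun ω => by positivity
  have heint : Integrable e P :=
    (lintegral_ofReal_ne_top_iff_integrable hem.aestronglyMeasurable he0).1 hL
  have heL : ∫ ω, e ω ∂P = (∫⁻ ω, ENNReal.ofReal (e ω) ∂P).toReal :=
    integral_eq_lintegral_of_nonneg_ae he0 hem.aestronglyMeasurable
  have hrpos : ∀ᵐ ω ∂P, 0 < r (W ω, (X ω, V ω)) :=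
    ae_of_ae_map hJm.aemeasurable (Measure.rnDeriv_pos hJQ)
  have hrfin : ∀ᵐ ω ∂P, r (W ω, (X ω, V ω)) < ∞ :=
    ae_of_ae_map hJm.aemeasurable (hJQ.ae_le (Measure.rnDeriv_lt_top _ _))
  have hppos : ∀ᵐ ω ∂P, 0 < condDensity P X W (W ω, X ω) :=
    ae_of_ae_map hWX.aemeasurable (Measure.rnDeriv_pos hac)
  have hpfin : ∀ᵐ ω ∂P, condDensity P X W (W ω, X ω) < ∞ :=
    ae_of_ae_map hWX.aemeasurable (hac.ae_le (Measure.rnDeriv_lt_top _ _))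
  -- `u = g / (r p)`, the ratio of the Gaussian model to the true joint density
  have key (s : ℝ) (hs : 0 < s) : ∃ u : Ω → ℝ, Integrable u P ∧ ∫ ω, u ω ∂P ≤ 1 ∧
      ∀ᵐ ω ∂P, -b ω ≤ a ω + d / 2 * Real.log (2 * Real.pi * s) + 1 / (2 * s) * e ω
        + (u ω - 1) := by
    set F : C × (EuclideanSpace ℝ (Fin d) × B) → ℝ≥0∞ := fun q =>
      ENNReal.ofReal (isotropicGaussianPDF d s (q.2.1 - f (q.1, q.2.2)))
        / condDensity P X W (q.1, q.2.1) with hF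
    have hFm : Measurable F := by fun_prop
    set U : Ω → ℝ≥0∞ := fun ω => F (W ω, (X ω, V ω)) / r (W ω, (X ω, V ω)) with hU
    have hUm : Measurable U := by fun_prop
    have hU1 : ∫⁻ ω, U ω ∂P ≤ 1 := calc
      ∫⁻ ω, U ω ∂P = ∫⁻ q, F q / r q ∂J := by rw [hJ, lintegral_map (by fun_prop) hJm]
      _ = ∫⁻ q, r q * (F q / r q) ∂Q :=
        (lintegral_rnDeriv_mul hJQ (hFm.div hrm).aemeasurable).symm
      _ ≤ ∫⁻ q, F q ∂Q := lintegral_mono fun q => ENNReal.mul_div_le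
      _ ≤ 1 := lintegral_gaussian_div_condDensity_le hX hW hf hs hac
    have hUfin : ∫⁻ ω, U ω ∂P ≠ ∞ := ne_top_of_le_ne_top ENNReal.one_ne_top hU1
    refine ⟨fun ω => (U ω).toReal, integrable_toReal_of_lintegral_ne_top hUm.aemeasurable hUfin,
      ?_, ?_⟩
    · rw [integral_toReal hUm.aemeasurable (ae_lt_top hUm hUfin)]
      exact ENNReal.toReal_le_of_le_ofReal zero_le_one (by simpa using hU1)
    · filter_upwards [hrpos, hrfin, hppos, hpfin] with ω h1 h2 h3 h4
      have h1' := ENNReal.toReal_pos h1.ne' h2.ne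
      have h3' := ENNReal.toReal_pos h3.ne' h4.ne
      have hg := isotropicGaussianPDF_pos hs (X ω - f (W ω, V ω))
      have hUeq : (U ω).toReal = isotropicGaussianPDF d s (X ω - f (W ω, V ω))
          / (condDensity P X W (W ω, X ω)).toReal / (r (W ω, (X ω, V ω))).toReal := by
        simp only [hU, hF, ENNReal.toReal_div, ENNReal.toReal_ofReal hg.le]
      have hlog := Real.log_le_sub_one_of_pos
        (show 0 < (U ω).toReal by rw [hUeq]; positivity)
      rw [hUeq, Real.log_div (by positivity) h1'.ne', Real.log_div hg.ne' h3'.ne',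
        log_isotropicGaussianPDF hs, ← hUeq, norm_sub_rev] at hlog
      simp only [ha, hb, he]
      linarith
  have hA : ∫⁻ ω, ENNReal.ofReal (-b ω) ∂P ≠ ∞ := by
    obtain ⟨u, hu, -, hle⟩ := key 1 one_pos
    have hint : Integrable (fun ω => a ω + d / 2 * Real.log (2 * Real.pi * 1)
        + 1 / (2 * 1) * e ω + (u ω - 1)) P := by fun_prop
    refine ne_top_of_le_ne_top hint.lintegral_lt_top.ne (lintegral_mono_ae ?_)
    filter_upwards [hle] with ω hω using ENNReal.ofReal_le_ofReal hω
  have hbint : Integrable b P := by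
    refine ⟨hbm.aestronglyMeasurable, ?_⟩
    rw [hasFiniteIntegral_iff_norm]
    calc ∫⁻ ω, ENNReal.ofReal ‖b ω‖ ∂P
        ≤ ∫⁻ ω, (ENNReal.ofReal (b ω) + ENNReal.ofReal (-b ω)) ∂P := by
          refine lintegral_mono fun ω => ?_
          rcases abs_cases (b ω) with h | h <;> simp [Real.norm_eq_abs, h.1]
      _ = ∫⁻ ω, ENNReal.ofReal (b ω) ∂P + ∫⁻ ω, ENNReal.ofReal (-b ω) ∂P :=
          lintegral_add_left (by fun_prop) _
      _ < ∞ := ENNReal.add_lt_top.2 ⟨hB.lt_top, hA.lt_top⟩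
  refine ⟨∫ ω, -b ω ∂P, ?_, fun s hs => ?_⟩
  · rw [condDiffEntropy, if_pos hac, integral_neg,
      integral_eq_lintegral_pos_part_sub_lintegral_neg_part hbint, neg_sub, EReal.coe_sub,
      EReal.coe_ennreal_toReal hA, EReal.coe_ennreal_toReal hB]
  · obtain ⟨u, hu, hu1, hle⟩ := key s hs
    calc ∫ ω, -b ω ∂P
        ≤ ∫ ω, (a ω + d / 2 * Real.log (2 * Real.pi * s) + 1 / (2 * s) * e ω + (u ω - 1)) ∂P :=
          integral_mono_ae hbint.neg (by fun_prop) hle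
      _ = ∫ ω, a ω ∂P + d / 2 * Real.log (2 * Real.pi * s) + 1 / (2 * s) * ∫ ω, e ω ∂P
          + (∫ ω, u ω ∂P - 1) := by
          rw [integral_add (by fun_prop) (by fun_prop), integral_add (by fun_prop) (by fun_prop),
            integral_add haint (by fun_prop), integral_sub hu (by fun_prop),
            integral_const_mul (1 / (2 * s)) e]
          simp
      _ ≤ _ := by rw [haI, heL]; linarith

/-- The estimate of `exists_condDiffEntropy_le` with the variance `s` chosen optimally: the mean
squared error per coordinate. When the error vanishes, `s` tends to `0` instead, and the
information is infinite. -/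
lemma neg_log_add_le_condMutualInfo (hd : 1 ≤ d) (hX : Measurable X) (hV : Measurable V)
    (hW : Measurable W) (hf : Measurable f) :
    -ENNReal.log (∫⁻ ω, ENNReal.ofReal (‖f (W ω, V ω) - X ω‖ ^ 2) ∂P)
        + ((Real.log (d / (2 * Real.pi * Real.exp 1)) : ℝ) : EReal)
        + ((2 / d : ℝ) : EReal) * condDiffEntropy P X W
      ≤ ((2 / d : ℝ) : EReal) * (condMutualInfo P X V W : EReal) := by
  have hd0 : (0 : ℝ) < d := by exact_mod_cast hd
  have h2d : (0 : ℝ) < 2 / d := by positivity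
  have hπ := Real.pi_pos
  by_cases hbot : condDiffEntropy P X W = ⊥
  · simp [hbot, EReal.coe_mul_bot_of_pos h2d]
  by_cases hL : ∫⁻ ω, ENNReal.ofReal (‖f (W ω, V ω) - X ω‖ ^ 2) ∂P = ∞
  · rw [hL, ENNReal.log_top, EReal.neg_top, EReal.bot_add, EReal.bot_add]
    exact bot_le
  by_cases hI : condMutualInfo P X V W = ∞
  · simp [hI, EReal.coe_mul_top_of_pos h2d]
  have hac : P.map (fun ω => (W ω, X ω)) ≪
      (P.map W).prod (volume : Measure (EuclideanSpace ℝ (Fin d))) := by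
    by_contra hac
    exact hbot (by rw [condDiffEntropy, if_neg hac])
  have hB : ∫⁻ ω, ENNReal.ofReal (Real.log (condDensity P X W (W ω, X ω)).toReal) ∂P ≠ ∞ := by
    intro hB
    exact hbot (by rw [condDiffEntropy, if_pos hac, hB, EReal.coe_ennreal_top, EReal.sub_top])
  obtain ⟨h, hh, hle⟩ := exists_condDiffEntropy_le hX hV hW hf hac hB hI hL
  set L := ∫⁻ ω, ENNReal.ofReal (‖f (W ω, V ω) - X ω‖ ^ 2) ∂P
  set I := condMutualInfo P X V W
  rcases eq_or_ne L 0 with hL0 | hL0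
  · -- `h ≤ I + (d / 2) log (2πs)` for all `s > 0` is absurd: take `log (2πs) = 2 (h - I - 1) / d`
    exfalso
    have := hle (Real.exp (2 / d * (h - I.toReal - 1)) / (2 * Real.pi)) (by positivity)
    rw [mul_div_cancel₀ _ (by positivity), Real.log_exp, hL0] at this
    have hcancel : (d : ℝ) / 2 * (2 / d * (h - I.toReal - 1)) = h - I.toReal - 1 := by
      field_simp
    simp only [ENNReal.toReal_zero, mul_zero, hcancel] at this
    linarith
  · have hLpos : 0 < L.toReal := ENNReal.toReal_pos hL0 hL
    have hs := hle (L.toReal / d) (by positivity)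
    rw [hh, ENNReal.log_pos_real hL0 hL, ← EReal.coe_ennreal_toReal hI]
    norm_cast
    have hlog : Real.log (d / (2 * Real.pi * Real.exp 1))
        = Real.log L.toReal - Real.log (2 * Real.pi * (L.toReal / d)) - 1 := by
      rw [Real.log_div hd0.ne' (by positivity),
        Real.log_mul (show 2 * Real.pi ≠ 0 by positivity) (Real.exp_pos 1).ne', Real.log_exp,
        Real.log_mul (show 2 * Real.pi ≠ 0 by positivity) (by positivity),
        Real.log_div hLpos.ne' hd0.ne']
      ring
    have hmul := mul_le_mul_of_nonneg_left hs h2d.le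
    have hexp : 2 / d * (I.toReal + d / 2 * Real.log (2 * Real.pi * (L.toReal / d))
          + 1 / (2 * (L.toReal / d)) * L.toReal)
        = 2 / d * I.toReal + Real.log (2 * Real.pi * (L.toReal / d)) + 1 := by
      field_simp
    rw [hexp] at hmul
    rw [hlog]
    linarith

end Gibbs

/-! ### The bound for noised data -/

theorem theorem3 {Ω Z : Type*} [MeasurableSpace Ω]
    [MeasurableSpace Z] [StandardBorelSpace Z] [Nonempty Z]
    (P : Measure Ω) [IsProbabilityMeasure P] (d : ℕ) (hd : 1 ≤ d)
    (T : ℝ) (α σ : ℝ → ℝ) (x : ℝ → Ω → EuclideanSpace ℝ (Fin d))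
    (hx : IsForwardProcess P T α σ x)
    (Eφ : EuclideanSpace ℝ (Fin d) → Z) (hE : Measurable Eφ)
    (t : ℝ) (ht : t ∈ Icc 0 T)
    (xθ : EuclideanSpace ℝ (Fin d) → ℝ → Z → EuclideanSpace ℝ (Fin d))
    (hθ : Measurable (fun p : EuclideanSpace ℝ (Fin d) × Z => xθ p.1 t p.2)) :
    (2 ≤ d →
      -ENNReal.log (condDSMLoss P x Eφ xθ t)
          + ((Real.log (d / (2 * Real.pi * Real.exp 1)) : ℝ) : EReal)
          + ((2 / d : ℝ) : EReal) * condDiffEntropy P (x 0) (x t)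
        ≤ (condMutualInfo P (x 0) (fun ω => Eφ (x 0 ω)) (x t) : EReal)) ∧
    -ENNReal.log (condDSMLoss P x Eφ xθ t)
        + ((Real.log (d / (2 * Real.pi * Real.exp 1)) : ℝ) : EReal)
        + ((2 / d : ℝ) : EReal) * condDiffEntropy P (x 0) (x t)
      ≤ ((2 / d : ℝ) : EReal) *
          (condMutualInfo P (x 0) (fun ω => Eφ (x 0 ω)) (x t) : EReal) := by
  have hX : Measurable (x 0) := hx.measurable 0 ⟨le_rfl, ht.1.trans ht.2⟩
  have hW : Measurable (x t) := hx.measurable t ht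
  have hmain := neg_log_add_le_condMutualInfo (P := P) hd hX (hE.comp hX) hW hθ
  refine ⟨fun h2 => hmain.trans ?_, hmain⟩
  -- for `d ≥ 2` the factor `2 / d` is at most `1`
  have h2d : (2 / d : ℝ) ≤ 1 := by
    rw [div_le_one (by positivity)]
    exact_mod_cast h2
  exact mul_le_of_le_one_left (EReal.coe_ennreal_nonneg _) (by exact_mod_cast h2d)
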